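/- Let $\mathbb{BC}=\{Z=z_1+jz_2:\ z_1,z_2\in\mathbb C\}$ be the bicomplex numbers ($j^2=-1$, $ij=ji$), let $e_\pm=\frac{1\pm ij}{2}$, and write $Z=\alpha e_++\beta e_-$ with $\alpha=z_1-iz_2$, $\beta=z_1+iz_2\in\mathbb C$. Let $\mathbb D=\{x+y\,ij:\ x,y\in\mathbb R\}$ be the hyperbolic numbers and let $\Re_{hyp}(Z)=\Re(\alpha)e_++\Re(\beta)e_-$. Put $$\partial_Z=\partial_\alpha e_++\partial_\beta e_-,\quad \partial_{Z^*}=\partial_{\bar\alpha}e_++\partial_{\bar\beta}e_-,\quad \partial_{Z^\dagger}=\partial_\beta e_++\partial_\alpha e_-,\quad \partial_{\widetilde Z}=\partial_{\bar\beta}e_++\partial_{\bar\alpha}e_-,$$ and $\Delta_{bc}=\partial_Z\partial_{Z^*}$. For an integer $\ell\ge 0$, call $F:\mathbb{BC}\to\mathbb{BC}$ $\Delta_{bc}$-polyharmonic of order $\ell$ if $F$ is of class $C^{2\ell}$ (in the real sense) and $\Delta_{bc}^{\ell}F=0$ (so $\ell$ need not be the least such integer). For integers $n\ge 0$ let $A_n$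 be the set of functions $\varphi(z)=\sum_{l=0}^{n-1}a_l(z)\bar z^{\,l}$ on $\mathbb C$ with $a_0,\dots,a_{n-1}$ entire and $a_{n-1}\not\equiv 0$ (with $A_0=\{0\}$), and let $\mathcal A^{[1]}_{m,n}(\mathbb{BC})$, the $(m,n)$-bc-polyholomorphic functions of first kind, be the set of functions $f(\alpha e_++\beta e_-)=\varphi(\alpha)e_++\psi(\beta)e_-$ with $\varphi\in A_m$, $\psi\in A_n$. **Theorem.** (i) For all integers $m,n\ge 0$ and every $f\in\mathcal A^{[1]}_{m,n}(\mathbb{BC})$, the function $\Re_{hyp}(f)$ is $\Delta_{bc}$-polyharmonic of order $\max(m,n)$. (ii) Conversely, if $F:\mathbb{BC}\to\mathbb D$ is $\Delta_{bc}$-polyharmonic of order $\ell$ and $\partial_{Z^\dagger}F=\partial_{\widetilde Z}F=0$, then there are integers $m,n\ge 0$ with $\max(m,n)=\ell$ and a function $f\in\mathcal A^{[1]}_{m,n}(\mathbb{BC})$ such that $F=\Re_{hyp}(f)$. -/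

import Mathlib

open scoped ComplexConjugate

noncomputable section

namespace Bicomplex

/-- The bicomplex numbers `Z = z₁ + j z₂` with `z₁, z₂ ∈ ℂ` and `j² = -1`, `ij = ji`:
the quadratic algebra `ℂ[j]`, where `Z.re = z₁` and `Z.im = z₂` (both complex). -/
abbrev BC : Type := QuadraticAlgebra ℂ (-1) 0

/-- The real-linear coordinates `Z ↦ (z₁, z₂)`. -/
def coords : BC →ₗ[ℝ] ℂ × ℂ where
  toFun Z := (Z.re, Z.im)
  map_add' _ _ := rfl
  map_smul' _ _ := rfl

theorem coords_injective : Function.Injective coords := fun _ _ h =>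
  QuadraticAlgebra.ext (congrArg Prod.fst h) (congrArg Prod.snd h)

/-- The norm of `ℂ × ℂ` on `BC` (a real space of dimension four, so any norm gives the same
calculus). -/
instance : NormedAddCommGroup BC :=
  NormedAddCommGroup.induced BC (ℂ × ℂ) coords coords_injective

instance : NormedSpace ℝ BC := NormedSpace.induced ℝ BC (ℂ × ℂ) coords

/-! ### Units, idempotents, conjugations -/

/-- The imaginary unit `i`. -/
def i : BC := ⟨Complex.I, 0⟩

/-- The imaginary unit `j`. -/
def j : BC := ⟨0, 1⟩

/-- The hyperbolic unit `k = ij`. -/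
def k : BC := i * j

/-- The embedding of the complex numbers `ℂ = ℝ + iℝ`. -/
def ofC (z : ℂ) : BC := ⟨z, 0⟩

/-- The idempotent `e₊ = (1 + ij)/2`. -/
def ePlus : BC := (2⁻¹ : ℝ) • (1 + k)

/-- The idempotent `e₋ = (1 - ij)/2`. -/
def eMinus : BC := (2⁻¹ : ℝ) • (1 - k)

/-- The first idempotent coordinate `α = z₁ - i z₂`. -/
def alpha (Z : BC) : ℂ := Z.re - Complex.I * Z.im

/-- The second idempotent coordinate `β = z₁ + i z₂`. -/
def beta (Z : BC) : ℂ := Z.re + Complex.I * Z.im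

/-- The conjugate `Z* = conj z₁ - j conj z₂`. -/
def starConj (Z : BC) : BC := ⟨conj Z.re, -conj Z.im⟩

/-- The hyperbolic numbers `𝔻 = {x + y k : x, y ∈ ℝ}`. -/
def hyperbolic : Set BC := {Z | ∃ x y : ℝ, Z = x • (1 : BC) + y • k}

/-- The hyperbolic real part `Re(α) e₊ + Re(β) e₋`. -/
def reHyp (Z : BC) : BC := (alpha Z).re • ePlus + (beta Z).re • eMinus

theorem eq_alpha_beta (Z : BC) : Z = ofC (alpha Z) * ePlus + ofC (beta Z) * eMinus := by
  ext <;> simp [ofC, alpha, beta, ePlus, eMinus, k, i, j, Complex.ext_iff, QuadraticAlgebra.re_one,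
    QuadraticAlgebra.im_one] <;> ring_nf <;> simp

theorem reHyp_eq (Z : BC) : reHyp Z = (2⁻¹ : ℝ) • (Z + starConj Z) := by
  ext <;> simp [reHyp, starConj, alpha, beta, ePlus, eMinus, k, i, j, Complex.ext_iff,
    QuadraticAlgebra.re_one, QuadraticAlgebra.im_one] <;> ring_nf

/-! ### Differential operators -/

/-- The directional derivative of `f` along `v`. The real coordinates of
`Z = (x₁ + i y₁) + j (x₂ + i y₂)` have the directions `1`, `i`, `j`, `k = ij`. -/
def pd (v : BC) (f : BC → BC) (Z : BC) : BC := fderiv ℝ f Z v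

/-- `∂/∂z₁ = (∂/∂x₁ - i ∂/∂y₁)/2`. -/
def dz1 (f : BC → BC) (Z : BC) : BC := (2⁻¹ : ℝ) • (pd 1 f Z - i * pd i f Z)

/-- `∂/∂z₂ = (∂/∂x₂ - i ∂/∂y₂)/2`. -/
def dz2 (f : BC → BC) (Z : BC) : BC := (2⁻¹ : ℝ) • (pd j f Z - i * pd k f Z)

/-- `∂/∂(conj z₁) = (∂/∂x₁ + i ∂/∂y₁)/2`. -/
def dz1bar (f : BC → BC) (Z : BC) : BC := (2⁻¹ : ℝ) • (pd 1 f Z + i * pd i f Z)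

/-- `∂/∂(conj z₂) = (∂/∂x₂ + i ∂/∂y₂)/2`. -/
def dz2bar (f : BC → BC) (Z : BC) : BC := (2⁻¹ : ℝ) • (pd j f Z + i * pd k f Z)

/-- `∂/∂Z = (∂/∂z₁ - j ∂/∂z₂)/2 = ∂/∂α e₊ + ∂/∂β e₋`. -/
def dZ (f : BC → BC) (Z : BC) : BC := (2⁻¹ : ℝ) • (dz1 f Z - j * dz2 f Z)

/-- `∂/∂Z* = (∂/∂(conj z₁) + j ∂/∂(conj z₂))/2 = ∂/∂(conj α) e₊ + ∂/∂(conj β) e₋`. -/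
def dZstar (f : BC → BC) (Z : BC) : BC := (2⁻¹ : ℝ) • (dz1bar f Z + j * dz2bar f Z)

/-- `∂/∂Z† = (∂/∂z₁ + j ∂/∂z₂)/2 = ∂/∂β e₊ + ∂/∂α e₋`. -/
def dZdagger (f : BC → BC) (Z : BC) : BC := (2⁻¹ : ℝ) • (dz1 f Z + j * dz2 f Z)

/-- `∂/∂Z̃ = (∂/∂(conj z₁) - j ∂/∂(conj z₂))/2 = ∂/∂(conj β) e₊ + ∂/∂(conj α) e₋`. -/
def dZtilde (f : BC → BC) (Z : BC) : BC := (2⁻¹ : ℝ) • (dz1bar f Z - j * dz2bar f Z)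

/-- The bicomplex Laplacian `Δ_bc = ∂²/∂Z∂Z*`. -/
def laplacianBC (f : BC → BC) : BC → BC := dZ (dZstar f)

/-- `F` is `Δ_bc`-polyharmonic of order `n`: it is of class `C^{2n}` and `Δ_bc^n F = 0`. -/
def IsPolyharmonic (n : ℕ) (F : BC → BC) : Prop :=
  ContDiff ℝ ((2 * n : ℕ) : WithTop ℕ∞) F ∧ ∀ Z, laplacianBC^[n] F Z = 0

/-! ### Polyholomorphic functions -/

/-- The entire polyanalytic functions `∑_{l < n} a_l(z) (conj z)^l` of exact order `n`: the `a_l`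
are entire and the top coefficient `a_{n-1}` is not identically zero. For `n = 0` the sum is empty,
and the only element is the zero function. -/
def polyanalytic (n : ℕ) : Set (ℂ → ℂ) :=
  {φ | ∃ a : ℕ → ℂ → ℂ, (∀ l < n, Differentiable ℂ (a l)) ∧
    (∀ l, l + 1 = n → ∃ z, a l z ≠ 0) ∧
    ∀ z, φ z = ∑ l ∈ Finset.range n, a l z * conj z ^ l}

/-- The class `A^{[1]}_{m,n}(BC)` of bc-polyholomorphic functions of first kind of order `(m, n)`:
`f(α e₊ + β e₋) = φ(α) e₊ + ψ(β) e₋` with `φ`, `ψ` polyanalytic of exact orders `m`, `n`. -/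
def polyholomorphic (m n : ℕ) : Set (BC → BC) :=
  {f | ∃ φ ∈ polyanalytic m, ∃ ψ ∈ polyanalytic n,
    ∀ Z, f Z = ofC (φ (alpha Z)) * ePlus + ofC (ψ (beta Z)) * eMinus}

end Bicomplex

end

/-! The map `Z ↦ (alpha Z, beta Z)` identifies `BC` with `ℂ × ℂ` as a ring, and on a function `split
u v`, that is `u(α) e₊ + v(β) e₋`, the bicomplex Laplacian acts as `qlap = ∂∂̄` on `u` and `v`
separately (`laplacianBC_split`). Both directions thus become statements about the plane.

For (i), `qlap^[n]` sends `a(z) b(z̄)` to `a⁽ⁿ⁾(z) b⁽ⁿ⁾(z̄)`, so it kills `a(z) z̄ˡ` for `l < n`;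
being a real operator, it commutes with taking real parts.

For (ii), the idempotent components of `F` are real. A real function with vanishing Wirtinger
derivative in a variable does not depend on that variable, so `∂F/∂Z† = 0` makes `F` split. Each
component is then a real polyharmonic function of the plane, and an Almansi decomposition
(`exists_eq_re_sum`) writes it as the real part of a polyanalytic function. Its order can be made
exactly `l` (`exists_mem_polyanalytic_re_eq`), so `m = n = l` works. -/

noncomputable section

namespace PolyanalyticPlane

open Laplacian InnerProductSpace Complex

/-! ### Wirtinger derivatives and the Laplacian of the complex plane -/

/-- The Wirtinger derivative `∂/∂z`. -/
def wirt (f : ℂ → ℂ) (z : ℂ) : ℂ := 2⁻¹ * (fderiv ℝ f z 1 - I * fderiv ℝ f z I)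

/-- The Wirtinger derivative `∂/∂(conj z)`. -/
def wirtBar (f : ℂ → ℂ) (z : ℂ) : ℂ := 2⁻¹ * (fderiv ℝ f z 1 + I * fderiv ℝ f z I)

variable {E : Type*} [NormedAddCommGroup E] [NormedSpace ℝ E]
variable {G : Type*} [NormedAddCommGroup G] [NormedSpace ℝ G]

/-- A quarter of the Laplacian of the complex plane, which is `∂²/∂z∂(conj z)`. -/
def qlap (f : ℂ → E) (z : ℂ) : E := (4⁻¹ : ℝ) • Δ f z

theorem laplacian_eq_fderiv_fderiv (f : ℂ → E) (z : ℂ) :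
    Δ f z = fderiv ℝ (fderiv ℝ f) z 1 1 + fderiv ℝ (fderiv ℝ f) z I I := by
  rw [laplacian_eq_iteratedFDeriv_complexPlane]
  simp [iteratedFDeriv_two_apply]

theorem contDiff_wirtBar {f : ℂ → ℂ} {n m : WithTop ℕ∞} (hf : ContDiff ℝ n f) (h : m + 1 ≤ n) :
    ContDiff ℝ m (wirtBar f) := by
  have h' := hf.fderiv_right h
  unfold wirtBar
  fun_prop

theorem contDiff_qlap {f : ℂ → E} {n m : WithTop ℕ∞} (hf : ContDiff ℝ n f) (h : m + 2 ≤ n) :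
    ContDiff ℝ m (qlap f) := by
  have h' : ContDiff ℝ m (fderiv ℝ (fderiv ℝ f)) := by
    refine (hf.fderiv_right (m := m + 1) ?_).fderiv_right le_rfl
    rwa [add_assoc, one_add_one_eq_two]
  have : qlap f = fun z ↦ (4⁻¹ : ℝ) • (fderiv ℝ (fderiv ℝ f) z 1 1 +
      fderiv ℝ (fderiv ℝ f) z I I) := by
    funext z; rw [qlap, laplacian_eq_fderiv_fderiv]
  rw [this]
  fun_prop

theorem two_mul_succ_cast (n : ℕ) :
    ((2 * (n + 1) : ℕ) : WithTop ℕ∞) = ((2 * n : ℕ) : WithTop ℕ∞) + 2 := by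
  rw [mul_add, mul_one]; push_cast; rfl

theorem two_le_two_mul_succ (n : ℕ) : (2 : WithTop ℕ∞) ≤ ((2 * (n + 1) : ℕ) : WithTop ℕ∞) := by
  rw [two_mul_succ_cast]; exact le_add_self

theorem contDiff_qlap_succ {f : ℂ → E} {n : ℕ}
    (hf : ContDiff ℝ ((2 * (n + 1) : ℕ) : WithTop ℕ∞) f) :
    ContDiff ℝ ((2 * n : ℕ) : WithTop ℕ∞) (qlap f) :=
  contDiff_qlap hf (two_mul_succ_cast n).ge

theorem contDiff_qlap_iterate {f : ℂ → E} (n : ℕ) :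
    ContDiff ℝ ((2 * (n + 1) : ℕ) : WithTop ℕ∞) f → ContDiff ℝ 2 (qlap^[n] f) := by
  induction n generalizing f with
  | zero => intro hf; simpa using hf
  | succ n ih => intro hf; exact ih (contDiff_qlap_succ hf)

theorem wirt_wirtBar {f : ℂ → ℂ} (hf : ContDiff ℝ 2 f) : wirt (wirtBar f) = qlap f := by
  funext z
  have h' : ContDiff ℝ 1 (fderiv ℝ f) := hf.fderiv_right (by norm_num)
  have hd : DifferentiableAt ℝ (fderiv ℝ f) z := (h'.differentiable (by norm_num)) z
  have key (v : ℂ) : fderiv ℝ (wirtBar f) z v =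
      2⁻¹ * (fderiv ℝ (fderiv ℝ f) z v 1 + I * fderiv ℝ (fderiv ℝ f) z v I) := by
    have h1 (w : ℂ) : HasFDerivAt (fun z ↦ fderiv ℝ f z w)
        ((ContinuousLinearMap.apply ℝ ℂ w).comp (fderiv ℝ (fderiv ℝ f) z)) z :=
      (ContinuousLinearMap.apply ℝ ℂ w).hasFDerivAt.comp z hd.hasFDerivAt
    have h2 := ((h1 1).add ((h1 I).const_mul I)).const_mul (2⁻¹ : ℂ)
    have h3 : HasFDerivAt (wirtBar f) _ z := h2
    rw [h3.fderiv]
    simp [mul_add]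
  -- Symmetry of the second derivative cancels the mixed terms of `∂∂̄`.
  have hsymm := (hf.contDiffAt (x := z)).isSymmSndFDerivAt (by simp) 1 I
  rw [wirt, key, key, qlap, laplacian_eq_fderiv_fderiv, hsymm, Complex.real_smul]
  push_cast
  linear_combination (-(4⁻¹ : ℂ) * fderiv ℝ (fderiv ℝ f) z I I) * I_mul_I

/-- A general real-linear `L` covers both the real part and the inclusion of `ℝ` in `ℂ`. -/
theorem qlap_comp_left {f : ℂ → E} (L : E →L[ℝ] G) (hf : ContDiff ℝ 2 f) :
    qlap (fun z ↦ L (f z)) = fun z ↦ L (qlap f z) := by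
  funext z
  have := (hf.contDiffAt (x := z)).laplacian_CLM_comp_left (l := L)
  simp only [qlap, map_smul]
  exact congrArg _ this

theorem qlap_iterate_comp_left (L : E →L[ℝ] G) (n : ℕ) {f : ℂ → E} :
    ContDiff ℝ ((2 * n : ℕ) : WithTop ℕ∞) f →
    qlap^[n] (fun z ↦ L (f z)) = fun z ↦ L (qlap^[n] f z) := by
  induction n generalizing f with
  | zero => intro _; rfl
  | succ n ih =>
    intro hf
    rw [Function.iterate_succ_apply, qlap_comp_left L (hf.of_le (two_le_two_mul_succ n)),
      ih (contDiff_qlap_succ hf), Function.iterate_succ_apply]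

theorem qlap_add {f g : ℂ → E} (hf : ContDiff ℝ 2 f) (hg : ContDiff ℝ 2 g) :
    qlap (f + g) = qlap f + qlap g := by
  funext z
  simp only [qlap, Pi.add_apply, hf.contDiffAt.laplacian_add hg.contDiffAt, smul_add]

theorem qlap_iterate_add (n : ℕ) {f g : ℂ → E} :
    ContDiff ℝ ((2 * n : ℕ) : WithTop ℕ∞) f → ContDiff ℝ ((2 * n : ℕ) : WithTop ℕ∞) g →
    qlap^[n] (f + g) = qlap^[n] f + qlap^[n] g := by
  induction n generalizing f g with
  | zero => intro _ _; rfl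
  | succ n ih =>
    intro hf hg
    simp only [Function.iterate_succ_apply]
    rw [qlap_add (hf.of_le (two_le_two_mul_succ n)) (hg.of_le (two_le_two_mul_succ n)),
      ih (contDiff_qlap_succ hf) (contDiff_qlap_succ hg)]

theorem qlap_zero : qlap (0 : ℂ → E) = 0 := by
  have h : Δ (0 : ℂ → E) = 0 := laplacian_const (c := (0 : E))
  funext z
  simp [qlap, h]

theorem qlap_iterate_zero (n : ℕ) : qlap^[n] (0 : ℂ → E) = 0 :=
  Function.iterate_fixed qlap_zero n

theorem qlap_iterate_sum {ι : Type*} (s : Finset ι) (n : ℕ) {f : ι → ℂ → E}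
    (hf : ∀ x ∈ s, ContDiff ℝ ((2 * n : ℕ) : WithTop ℕ∞) (f x)) :
    qlap^[n] (∑ x ∈ s, f x) = ∑ x ∈ s, qlap^[n] (f x) := by
  classical
  induction s using Finset.induction_on with
  | empty => simpa using qlap_iterate_zero n
  | insert x s hx ih =>
    rw [Finset.sum_insert hx, Finset.sum_insert hx, qlap_iterate_add n (hf _ (by simp)), ih]
    · exact fun y hy ↦ hf y (by simp [hy])
    · have h := ContDiff.sum (s := s) fun y hy ↦ hf y (by simp [hy])
      convert h using 1
      funext z; simp

/-! ### Products of a holomorphic and an antiholomorphic function -/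

theorem fderiv_mul_conj {a b : ℂ → ℂ} (ha : Differentiable ℂ a) (hb : Differentiable ℂ b)
    (z v : ℂ) : fderiv ℝ (fun z ↦ a z * b (conj z)) z v =
      deriv a z * v * b (conj z) + a z * (deriv b (conj z) * conj v) := by
  have h1 := (ha z).hasDerivAt.hasFDerivAt.restrictScalars ℝ
  have h2 : HasFDerivAt (fun z ↦ b (conj z)) _ z :=
    HasFDerivAt.comp z ((hb (conj z)).hasDerivAt.hasFDerivAt.restrictScalars ℝ)
      conjCLE.hasFDerivAt
  have h3 : HasFDerivAt (fun z ↦ a z * b (conj z)) _ z := h1.mul h2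
  rw [h3.fderiv]
  simp
  ring

theorem contDiff_mul_conj {a b : ℂ → ℂ} (ha : Differentiable ℂ a) (hb : Differentiable ℂ b)
    {n : WithTop ℕ∞} : ContDiff ℝ n (fun z ↦ a z * b (conj z)) := by
  have h1 : ContDiff ℝ n a := ha.contDiff.restrict_scalars ℝ
  have h2 : ContDiff ℝ n b := hb.contDiff.restrict_scalars ℝ
  exact h1.mul (h2.comp conjCLE.contDiff)

theorem wirtBar_mul_conj {a b : ℂ → ℂ} (ha : Differentiable ℂ a) (hb : Differentiable ℂ b) :
    wirtBar (fun z ↦ a z * b (conj z)) = fun z ↦ a z * deriv b (conj z) := by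
  funext z
  rw [wirtBar, fderiv_mul_conj ha hb, fderiv_mul_conj ha hb]
  simp only [map_one, conj_I]
  linear_combination
    2⁻¹ * (deriv a z * b (conj z) - a z * deriv b (conj z)) * I_mul_I

theorem wirt_mul_conj {a b : ℂ → ℂ} (ha : Differentiable ℂ a) (hb : Differentiable ℂ b) :
    wirt (fun z ↦ a z * b (conj z)) = fun z ↦ deriv a z * b (conj z) := by
  funext z
  rw [wirt, fderiv_mul_conj ha hb, fderiv_mul_conj ha hb]
  simp only [map_one, conj_I]
  linear_combination
    -2⁻¹ * (deriv a z * b (conj z) - a z * deriv b (conj z)) * I_mul_I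

/-- `∂̄` does not see the holomorphic factor and `∂` does not see the antiholomorphic one, so each
differentiates only its own factor. -/
theorem qlap_mul_conj {a b : ℂ → ℂ} (ha : Differentiable ℂ a) (hb : Differentiable ℂ b) :
    qlap (fun z ↦ a z * b (conj z)) = fun z ↦ deriv a z * deriv b (conj z) := by
  have hb' : Differentiable ℂ (deriv b) := hb.deriv
  rw [← wirt_wirtBar (contDiff_mul_conj ha hb), wirtBar_mul_conj ha hb, wirt_mul_conj ha hb']

theorem qlap_iterate_mul_conj (n : ℕ) {a b : ℂ → ℂ} :
    Differentiable ℂ a → Differentiable ℂ b →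
    qlap^[n] (fun z ↦ a z * b (conj z)) = fun z ↦ deriv^[n] a z * deriv^[n] b (conj z) := by
  induction n generalizing a b with
  | zero => intro _ _; rfl
  | succ n ih =>
    intro ha hb
    rw [Function.iterate_succ_apply, qlap_mul_conj ha hb, ih ha.deriv hb.deriv]
    rfl

theorem qlap_iterate_mul_conj_pow_self (n : ℕ) {a : ℂ → ℂ} (ha : Differentiable ℂ a) :
    qlap^[n] (fun z ↦ a z * conj z ^ n) = fun z ↦ (n.factorial : ℂ) * deriv^[n] a z := by
  rw [qlap_iterate_mul_conj n ha (differentiable_pow n)]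
  funext z
  simp only [← iteratedDeriv_eq_iterate, iteratedDeriv_pow]
  simp [mul_comm, Nat.descFactorial_self]

theorem qlap_iterate_mul_conj_pow_of_lt {n l : ℕ} (h : l < n) {a : ℂ → ℂ}
    (ha : Differentiable ℂ a) : qlap^[n] (fun z ↦ a z * conj z ^ l) = 0 := by
  rw [qlap_iterate_mul_conj n ha (differentiable_pow l)]
  funext z
  simp only [← iteratedDeriv_eq_iterate, iteratedDeriv_pow]
  simp [Nat.descFactorial_of_lt h]

/-! ### Almansi decomposition of real polyharmonic functions -/

/-- Entire functions have entire primitives; iterate. -/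
theorem exists_deriv_iterate_eq (n : ℕ) {f : ℂ → ℂ} : Differentiable ℂ f →
    ∃ g : ℂ → ℂ, Differentiable ℂ g ∧ deriv^[n] g = f := by
  induction n generalizing f with
  | zero => exact fun hf ↦ ⟨f, hf, rfl⟩
  | succ n ih =>
    intro hf
    obtain ⟨h, hh, rfl⟩ := ih hf
    obtain ⟨g, hg⟩ := hh.isExactOn_univ
    refine ⟨g, fun z ↦ (hg z trivial).differentiableAt, ?_⟩
    rw [Function.iterate_succ_apply]
    congr 1
    exact funext fun z ↦ (hg z trivial).deriv

/-- Almansi by induction: `qlap^[n] u` is harmonic on the plane, hence `Re G` with `G` entire. If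
`P⁽ⁿ⁾ = G / n!`, then `Re (P z̄ⁿ)` has the same `qlap^[n]` as `u`, and the difference has order `n`.
-/
theorem exists_eq_re_sum (n : ℕ) {u : ℂ → ℝ} :
    ContDiff ℝ ((2 * n : ℕ) : WithTop ℕ∞) u → qlap^[n] u = 0 →
    ∃ a : ℕ → ℂ → ℂ, (∀ l, Differentiable ℂ (a l)) ∧
      ∀ z, u z = (∑ l ∈ Finset.range n, a l z * conj z ^ l).re := by
  induction n generalizing u with
  | zero =>
    intro _ h
    exact ⟨fun _ _ ↦ 0, fun _ ↦ differentiable_const _, fun z ↦ by simpa using congrFun h z⟩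
  | succ n ih =>
    intro hu h
    have hg := contDiff_qlap_iterate n hu
    have hharm : HarmonicOnNhd (qlap^[n] u) Set.univ := by
      refine fun x _ ↦ ⟨hg.contDiffAt, Filter.Eventually.of_forall fun z ↦ ?_⟩
      rw [Function.iterate_succ_apply'] at h
      simpa [qlap] using congrFun h z
    obtain ⟨G, hG, hGre⟩ := hharm.exists_analyticOnNhd_univ_re_eq
    have hGd : Differentiable ℂ G := fun z ↦ (hG z trivial).differentiableAt
    -- The factor `1 / n!` compensates for the `n!` produced by differentiating `z̄ⁿ` `n` times.
    obtain ⟨P, hP, hPn⟩ := exists_deriv_iterate_eq n (hGd.const_mul ((n.factorial : ℂ)⁻¹))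
    have hsmooth : ContDiff ℝ ((2 * n : ℕ) : WithTop ℕ∞) (fun z ↦ (-P z) * conj z ^ n) :=
      contDiff_mul_conj hP.neg (differentiable_pow n)
    have hw := qlap_iterate_comp_left reCLM n hsmooth
    have hu' : ContDiff ℝ ((2 * n : ℕ) : WithTop ℕ∞) u :=
      hu.of_le (by rw [two_mul_succ_cast]; exact le_self_add)
    obtain ⟨a, ha, hsum⟩ := ih (hu'.add (reCLM.contDiff.comp hsmooth)) (by
      refine (qlap_iterate_add n hu' (reCLM.contDiff.comp hsmooth)).trans ?_
      have hP' : deriv^[n] (fun z ↦ -P z) = fun z ↦ -((n.factorial : ℂ)⁻¹ * G z) := by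
        funext z
        rw [← iteratedDeriv_eq_iterate, iteratedDeriv_fun_neg, iteratedDeriv_eq_iterate, hPn]
      have h1 := qlap_iterate_mul_conj_pow_self n hP.neg
      change qlap^[n] (fun z ↦ -P z * conj z ^ n) = fun z ↦ _ * deriv^[n] (fun z ↦ -P z) z at h1
      rw [hP'] at h1
      change _ + qlap^[n] (fun z ↦ reCLM (-P z * conj z ^ n)) = 0
      rw [hw, h1, ← hGre]
      funext z
      have hn : (n.factorial : ℂ) ≠ 0 := by exact_mod_cast n.factorial_ne_zero
      have : (n.factorial : ℂ) * -((n.factorial : ℂ)⁻¹ * G z) = -G z := by field_simp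
      simp only [Pi.add_apply, this]
      simp)
    refine ⟨fun l ↦ if l = n then P else a l, fun l ↦ ?_, fun z ↦ ?_⟩
    · dsimp only; split_ifs
      exacts [hP, ha l]
    · have h2 : u z + (-P z * conj z ^ n).re = _ := hsum z
      have h3 : ∑ l ∈ Finset.range n, (if l = n then P else a l) z * conj z ^ l =
          ∑ l ∈ Finset.range n, a l z * conj z ^ l :=
        Finset.sum_congr rfl fun l hl ↦ by rw [if_neg (Finset.mem_range.1 hl).ne]
      rw [Finset.sum_range_succ, h3, add_re, ← h2]
      simp only [↓reduceIte, neg_mul, neg_re]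
      ring

/-- The top coefficient of a polyanalytic function can be made nonzero without changing its real
part, by adding an imaginary multiple of `z ^ n * conj z ^ n`. -/
theorem exists_mem_polyanalytic_re_eq (n : ℕ) {u : ℂ → ℝ}
    (hu : ContDiff ℝ ((2 * n : ℕ) : WithTop ℕ∞) u) (h : qlap^[n] u = 0) :
    ∃ φ ∈ Bicomplex.polyanalytic n, ∀ z, u z = (φ z).re := by
  obtain ⟨a, ha, hsum⟩ := exists_eq_re_sum n hu h
  by_cases htop : ∀ l, l + 1 = n → ∃ z, a l z ≠ 0
  · exact ⟨_, ⟨a, fun l _ ↦ ha l, htop, fun _ ↦ rfl⟩, hsum⟩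
  push Not at htop
  -- The condition is vacuous for `n = 0`, so here `n = l + 1` and the top coefficient `a l`
  -- vanishes identically.
  obtain ⟨l, rfl, hl⟩ := htop
  refine ⟨_, ⟨fun m z ↦ if m = l then I * z ^ l else a m z, fun m _ ↦ ?_, ?_, fun _ ↦ rfl⟩,
    fun z ↦ ?_⟩
  · by_cases hm : m = l
    · simp [hm]
    · simpa [hm] using ha m
  · intro m hm
    obtain rfl : m = l := by omega
    exact ⟨1, by simp⟩
  · rw [hsum, Finset.sum_range_succ, Finset.sum_range_succ, hl, add_re, add_re]
    have h1 : (I * z ^ l * conj z ^ l).re = 0 := by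
      rw [mul_assoc, ← mul_pow, mul_conj, ← ofReal_pow, I_mul_re, ofReal_im, neg_zero]
    have h2 : ∑ m ∈ Finset.range l, (if m = l then I * z ^ l else a m z) * conj z ^ m =
        ∑ m ∈ Finset.range l, a m z * conj z ^ m :=
      Finset.sum_congr rfl fun m hm ↦ by rw [if_neg (Finset.mem_range.1 hm).ne]
    simp only [↓reduceIte]
    rw [h1, h2]
    simp

/-! ### Polyanalytic functions are smooth and polyharmonic -/

theorem contDiff_of_mem_polyanalytic {m : ℕ} {φ : ℂ → ℂ} (hφ : φ ∈ Bicomplex.polyanalytic m)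
    {n : WithTop ℕ∞} : ContDiff ℝ n φ := by
  obtain ⟨a, ha, -, h⟩ := hφ
  rw [funext h]
  exact ContDiff.sum fun l hl ↦
    contDiff_mul_conj (ha l (Finset.mem_range.1 hl)) (differentiable_pow l)

theorem qlap_iterate_of_mem_polyanalytic {m n : ℕ} (hmn : m ≤ n) {φ : ℂ → ℂ}
    (hφ : φ ∈ Bicomplex.polyanalytic m) : qlap^[n] φ = 0 := by
  obtain ⟨a, ha, -, h⟩ := hφ
  have : φ = ∑ l ∈ Finset.range m, fun z ↦ a l z * conj z ^ l := by
    funext z; rw [h, Finset.sum_apply]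
  rw [this, qlap_iterate_sum]
  · exact Finset.sum_eq_zero fun l hl ↦ qlap_iterate_mul_conj_pow_of_lt
      ((Finset.mem_range.1 hl).trans_le hmn) (ha l (Finset.mem_range.1 hl))
  · exact fun l hl ↦ contDiff_mul_conj (ha l (Finset.mem_range.1 hl)) (differentiable_pow l)

end PolyanalyticPlane

end

noncomputable section

namespace Bicomplex

open PolyanalyticPlane Complex

/-! ### Idempotent coordinates -/

theorem alpha_add (Z W : BC) : alpha (Z + W) = alpha Z + alpha W := by simp [alpha]; ring

theorem beta_add (Z W : BC) : beta (Z + W) = beta Z + beta W := by simp [beta]; ring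

theorem alpha_sub (Z W : BC) : alpha (Z - W) = alpha Z - alpha W := by simp [alpha]; ring

theorem beta_sub (Z W : BC) : beta (Z - W) = beta Z - beta W := by simp [beta]; ring

theorem alpha_smul (r : ℝ) (Z : BC) : alpha (r • Z) = r * alpha Z := by simp [alpha]; ring

theorem beta_smul (r : ℝ) (Z : BC) : beta (r • Z) = r * beta Z := by simp [beta]; ring

theorem alpha_mul (Z W : BC) : alpha (Z * W) = alpha Z * alpha W := by
  simp [alpha]; linear_combination -(Z.im * W.im) * I_mul_I

theorem beta_mul (Z W : BC) : beta (Z * W) = beta Z * beta W := by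
  simp [beta]; linear_combination -(Z.im * W.im) * I_mul_I

theorem alpha_zero : alpha 0 = 0 := by simp [alpha]

theorem beta_zero : beta 0 = 0 := by simp [beta]

theorem alpha_one : alpha 1 = 1 := by
  simp [alpha, QuadraticAlgebra.re_one, QuadraticAlgebra.im_one]

theorem beta_one : beta 1 = 1 := by
  simp [beta, QuadraticAlgebra.re_one, QuadraticAlgebra.im_one]

theorem alpha_i : alpha i = I := by simp [alpha, i]

theorem beta_i : beta i = I := by simp [beta, i]

theorem alpha_j : alpha j = -I := by simp [alpha, j]

theorem beta_j : beta j = I := by simp [beta, j]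

theorem alpha_k : alpha k = 1 := by rw [k, alpha_mul, alpha_i, alpha_j]; simp

theorem beta_k : beta k = -1 := by rw [k, beta_mul, beta_i, beta_j]; simp

theorem alpha_ofC (z : ℂ) : alpha (ofC z) = z := by simp [alpha, ofC]

theorem beta_ofC (z : ℂ) : beta (ofC z) = z := by simp [beta, ofC]

theorem alpha_ePlus : alpha ePlus = 1 := by
  rw [ePlus, alpha_smul, alpha_add, alpha_one, alpha_k]; norm_num

theorem beta_ePlus : beta ePlus = 0 := by
  rw [ePlus, beta_smul, beta_add, beta_one, beta_k]; norm_num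

theorem alpha_eMinus : alpha eMinus = 0 := by
  rw [eMinus, alpha_smul, alpha_sub, alpha_one, alpha_k]; norm_num

theorem beta_eMinus : beta eMinus = 1 := by
  rw [eMinus, beta_smul, beta_sub, beta_one, beta_k]; norm_num

/-- Reduces every identity in `BC` to two identities in `ℂ`. -/
theorem ext_alpha_beta {Z W : BC} (h1 : alpha Z = alpha W) (h2 : beta Z = beta W) : Z = W := by
  rw [eq_alpha_beta Z, eq_alpha_beta W, h1, h2]

/-- The bicomplex number `a e₊ + b e₋`. -/
def ofIdem (a b : ℂ) : BC := ofC a * ePlus + ofC b * eMinus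

theorem alpha_ofIdem (a b : ℂ) : alpha (ofIdem a b) = a := by
  simp [ofIdem, alpha_add, alpha_mul, alpha_ofC, alpha_ePlus, alpha_eMinus]

theorem beta_ofIdem (a b : ℂ) : beta (ofIdem a b) = b := by
  simp [ofIdem, beta_add, beta_mul, beta_ofC, beta_ePlus, beta_eMinus]

theorem alpha_reHyp (Z : BC) : alpha (reHyp Z) = (alpha Z).re := by
  simp [reHyp, alpha_add, alpha_smul, alpha_ePlus, alpha_eMinus]

theorem beta_reHyp (Z : BC) : beta (reHyp Z) = (beta Z).re := by
  simp [reHyp, beta_add, beta_smul, beta_ePlus, beta_eMinus]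

theorem alpha_of_mem_hyperbolic {Z : BC} (h : Z ∈ hyperbolic) :
    alpha Z = ((alpha Z).re : ℂ) := by
  obtain ⟨x, y, rfl⟩ := h
  simp [alpha_add, alpha_smul, alpha_one, alpha_k]

theorem beta_of_mem_hyperbolic {Z : BC} (h : Z ∈ hyperbolic) :
    beta Z = ((beta Z).re : ℂ) := by
  obtain ⟨x, y, rfl⟩ := h
  simp [beta_add, beta_smul, beta_one, beta_k]

/-- The real-linear coordinates `Z ↦ (z₁, z₂)` as a continuous linear equivalence. -/
def coordsCLE : BC ≃L[ℝ] ℂ × ℂ :=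
  LinearIsometryEquiv.toContinuousLinearEquiv
    { toFun := coords
      map_add' := map_add coords
      map_smul' := map_smul coords
      invFun := fun p ↦ ⟨p.1, p.2⟩
      left_inv := fun _ ↦ rfl
      right_inv := fun _ ↦ rfl
      norm_map' := fun _ ↦ rfl }

instance : FiniteDimensional ℝ BC :=
  coordsCLE.symm.toLinearEquiv.finiteDimensional

/-- `alpha` as a continuous real-linear map. -/
def alphaCLM : BC →L[ℝ] ℂ := LinearMap.toContinuousLinearMap
  { toFun := alpha
    map_add' := alpha_add
    map_smul' := fun r Z ↦ by simpa using alpha_smul r Z }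

/-- `beta` as a continuous real-linear map. -/
def betaCLM : BC →L[ℝ] ℂ := LinearMap.toContinuousLinearMap
  { toFun := beta
    map_add' := beta_add
    map_smul' := fun r Z ↦ by simpa using beta_smul r Z }

/-- `ofIdem` as a continuous real-linear map. -/
def ofIdemCLM : ℂ × ℂ →L[ℝ] BC := LinearMap.toContinuousLinearMap
  { toFun := fun p ↦ ofIdem p.1 p.2
    map_add' := fun p q ↦ ext_alpha_beta
      (by simp [alpha_add, alpha_ofIdem]) (by simp [beta_add, beta_ofIdem])
    map_smul' := fun r p ↦ ext_alpha_beta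
      (by simp [alpha_smul, alpha_ofIdem]) (by simp [beta_smul, beta_ofIdem]) }

/-! ### Functions that split along the idempotents -/

/-- The function `α e₊ + β e₋ ↦ u(α) e₊ + v(β) e₋`. -/
def split (u v : ℂ → ℂ) (Z : BC) : BC := ofIdem (u (alpha Z)) (v (beta Z))

theorem contDiff_split {u v : ℂ → ℂ} {n : WithTop ℕ∞} (hu : ContDiff ℝ n u)
    (hv : ContDiff ℝ n v) : ContDiff ℝ n (split u v) :=
  ofIdemCLM.contDiff.comp ((hu.comp alphaCLM.contDiff).prodMk (hv.comp betaCLM.contDiff))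

theorem pd_split {u v : ℂ → ℂ} (hu : Differentiable ℝ u) (hv : Differentiable ℝ v) (w Z : BC) :
    pd w (split u v) Z =
      ofIdem (fderiv ℝ u (alpha Z) (alpha w)) (fderiv ℝ v (beta Z) (beta w)) := by
  have h1 : HasFDerivAt (fun Z ↦ u (alpha Z)) ((fderiv ℝ u (alpha Z)).comp alphaCLM) Z :=
    HasFDerivAt.comp Z (hu (alpha Z)).hasFDerivAt alphaCLM.hasFDerivAt
  have h2 : HasFDerivAt (fun Z ↦ v (beta Z)) ((fderiv ℝ v (beta Z)).comp betaCLM) Z :=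
    HasFDerivAt.comp Z (hv (beta Z)).hasFDerivAt betaCLM.hasFDerivAt
  have h3 : HasFDerivAt (split u v) _ Z :=
    ofIdemCLM.hasFDerivAt.comp Z (h1.prodMk h2)
  rw [pd, h3.fderiv]
  rfl

/-- In the `alpha` component `j` and `k` become `-I` and `1`, in the `beta` component `I` and `-1`.
In each component the `z₁` and `z₂` halves of the operator both equal the same Wirtinger derivative,
and their mean is that derivative. -/
theorem dZstar_split {u v : ℂ → ℂ} (hu : Differentiable ℝ u) (hv : Differentiable ℝ v) :
    dZstar (split u v) = split (wirtBar u) (wirtBar v) := by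
  funext Z
  apply ext_alpha_beta
  · simp only [dZstar, dz1bar, dz2bar, pd_split hu hv, split, alpha_smul, alpha_add, alpha_mul,
      alpha_ofIdem, alpha_one, alpha_i, alpha_j, alpha_k, map_neg, wirtBar]
    push_cast
    linear_combination (-(4⁻¹ : ℂ) * fderiv ℝ u (alpha Z) 1) * I_mul_I
  · simp only [dZstar, dz1bar, dz2bar, pd_split hu hv, split, beta_smul, beta_add, beta_mul,
      beta_ofIdem, beta_one, beta_i, beta_j, beta_k, map_neg, wirtBar]
    push_cast
    linear_combination (-(4⁻¹ : ℂ) * fderiv ℝ v (beta Z) 1) * I_mul_I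

theorem dZ_split {u v : ℂ → ℂ} (hu : Differentiable ℝ u) (hv : Differentiable ℝ v) :
    dZ (split u v) = split (wirt u) (wirt v) := by
  funext Z
  apply ext_alpha_beta
  · simp only [dZ, dz1, dz2, pd_split hu hv, split, alpha_smul, alpha_sub, alpha_mul,
      alpha_ofIdem, alpha_one, alpha_i, alpha_j, alpha_k, map_neg, wirt]
    push_cast
    linear_combination (-(4⁻¹ : ℂ) * fderiv ℝ u (alpha Z) 1) * I_mul_I
  · simp only [dZ, dz1, dz2, pd_split hu hv, split, beta_smul, beta_sub, beta_mul,
      beta_ofIdem, beta_one, beta_i, beta_j, beta_k, map_neg, wirt]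
    push_cast
    linear_combination (-(4⁻¹ : ℂ) * fderiv ℝ v (beta Z) 1) * I_mul_I

theorem laplacianBC_split {u v : ℂ → ℂ} (hu : ContDiff ℝ 2 u) (hv : ContDiff ℝ 2 v) :
    laplacianBC (split u v) = split (qlap u) (qlap v) := by
  have h (f : ℂ → ℂ) (hf : ContDiff ℝ 2 f) : Differentiable ℝ (wirtBar f) :=
    (contDiff_wirtBar (m := 1) hf (by norm_num)).differentiable (by norm_num)
  rw [laplacianBC, dZstar_split (hu.differentiable (by norm_num)) (hv.differentiable (by norm_num)),
    dZ_split (h u hu) (h v hv), wirt_wirtBar hu, wirt_wirtBar hv]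

theorem laplacianBC_iterate_split (n : ℕ) {u v : ℂ → ℂ} :
    ContDiff ℝ ((2 * n : ℕ) : WithTop ℕ∞) u → ContDiff ℝ ((2 * n : ℕ) : WithTop ℕ∞) v →
    laplacianBC^[n] (split u v) = split (qlap^[n] u) (qlap^[n] v) := by
  induction n generalizing u v with
  | zero => intro _ _; rfl
  | succ n ih =>
    intro hu hv
    rw [Function.iterate_succ_apply, laplacianBC_split (hu.of_le (two_le_two_mul_succ n))
      (hv.of_le (two_le_two_mul_succ n)), ih (contDiff_qlap_succ hu) (contDiff_qlap_succ hv)]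
    rfl

theorem isPolyharmonic_reHyp_of_mem_polyholomorphic {m n : ℕ} {f : BC → BC}
    (hf : f ∈ polyholomorphic m n) : IsPolyharmonic (max m n) (fun Z ↦ reHyp (f Z)) := by
  obtain ⟨φ, hφ, ψ, hψ, hf⟩ := hf
  let L : ℂ →L[ℝ] ℂ := ofRealCLM.comp reCLM
  have hsplit : (fun Z ↦ reHyp (f Z)) = split (fun z ↦ L (φ z)) (fun z ↦ L (ψ z)) := by
    funext Z
    have hfZ : f Z = ofIdem (φ (alpha Z)) (ψ (beta Z)) := hf Z
    apply ext_alpha_beta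
    · rw [alpha_reHyp, hfZ, alpha_ofIdem, split, alpha_ofIdem]; rfl
    · rw [beta_reHyp, hfZ, beta_ofIdem, split, beta_ofIdem]; rfl
  have h1 {l : ℕ} {χ : ℂ → ℂ} (hχ : χ ∈ polyanalytic l) {r : WithTop ℕ∞} :
      ContDiff ℝ r (fun z ↦ L (χ z)) := L.contDiff.comp (contDiff_of_mem_polyanalytic hχ)
  refine ⟨?_, fun Z ↦ ?_⟩
  · rw [hsplit]
    exact contDiff_split (h1 hφ) (h1 hψ)
  · rw [hsplit, laplacianBC_iterate_split _ (h1 hφ) (h1 hψ),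
      qlap_iterate_comp_left L _ (contDiff_of_mem_polyanalytic hφ),
      qlap_iterate_comp_left L _ (contDiff_of_mem_polyanalytic hψ),
      qlap_iterate_of_mem_polyanalytic (le_max_left m n) hφ,
      qlap_iterate_of_mem_polyanalytic (le_max_right m n) hψ]
    apply ext_alpha_beta
    · simp [split, alpha_ofIdem, alpha_zero]
    · simp [split, beta_ofIdem, beta_zero]

/-! ### Splitting of hyperbolic-valued functions annihilated by `∂/∂Z†` -/

theorem alpha_pd_of_mem_hyperbolic {F : BC → BC} (hF : Differentiable ℝ F)
    (h : ∀ Z, F Z ∈ hyperbolic) (w Z : BC) : (alpha (pd w F Z)).im = 0 := by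
  have h1 : HasFDerivAt (fun Z ↦ (alpha (F Z)).im)
      (imCLM.comp (alphaCLM.comp (fderiv ℝ F Z))) Z :=
    imCLM.hasFDerivAt.comp Z (alphaCLM.hasFDerivAt.comp Z (hF Z).hasFDerivAt)
  have h2 : (fun Z ↦ (alpha (F Z)).im) = fun _ ↦ 0 := by
    funext Z; rw [alpha_of_mem_hyperbolic (h Z), ofReal_im]
  have h3 := h1.fderiv
  rw [h2, fderiv_fun_const] at h3
  exact (DFunLike.congr_fun h3 w).symm

theorem beta_pd_of_mem_hyperbolic {F : BC → BC} (hF : Differentiable ℝ F)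
    (h : ∀ Z, F Z ∈ hyperbolic) (w Z : BC) : (beta (pd w F Z)).im = 0 := by
  have h1 : HasFDerivAt (fun Z ↦ (beta (F Z)).im)
      (imCLM.comp (betaCLM.comp (fderiv ℝ F Z))) Z :=
    imCLM.hasFDerivAt.comp Z (betaCLM.hasFDerivAt.comp Z (hF Z).hasFDerivAt)
  have h2 : (fun Z ↦ (beta (F Z)).im) = fun _ ↦ 0 := by
    funext Z; rw [beta_of_mem_hyperbolic (h Z), ofReal_im]
  have h3 := h1.fderiv
  rw [h2, fderiv_fun_const] at h3
  exact (DFunLike.congr_fun h3 w).symm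

/-- Expresses the idempotent directions in the basis `1, i, j, k` in which the operators are
defined. -/
theorem ofIdem_eq_combination (a b : ℂ) : ofIdem a b =
    ((a.re + b.re) / 2) • (1 : BC) + ((a.im + b.im) / 2) • i + ((b.im - a.im) / 2) • j +
      ((a.re - b.re) / 2) • k := by
  apply ext_alpha_beta
  · simp only [alpha_ofIdem, alpha_add, alpha_smul, alpha_one, alpha_i, alpha_j, alpha_k]
    apply Complex.ext <;> simp <;> ring
  · simp only [beta_ofIdem, beta_add, beta_smul, beta_one, beta_i, beta_j, beta_k]
    apply Complex.ext <;> simp <;> ring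

theorem pd_ofIdem (F : BC → BC) (a b : ℂ) (Z : BC) : pd (ofIdem a b) F Z =
    ((a.re + b.re) / 2) • pd 1 F Z + ((a.im + b.im) / 2) • pd i F Z +
      ((b.im - a.im) / 2) • pd j F Z + ((a.re - b.re) / 2) • pd k F Z := by
  simp only [pd, ofIdem_eq_combination, map_add, map_smul]

/-- The `e₊` component of `∂F/∂Z†` is `∂/∂β` of `alpha ∘ F`. As `alpha ∘ F` is real, the real and
imaginary parts of this one complex equation are its two real partial derivatives in `β`, up to
constants, so both vanish. -/
theorem alpha_pd_eMinus_direction {F : BC → BC} (hF : Differentiable ℝ F)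
    (h : ∀ Z, F Z ∈ hyperbolic) (hd : ∀ Z, dZdagger F Z = 0) (b : ℂ) (Z : BC) :
    alpha (pd (ofIdem 0 b) F Z) = 0 := by
  have h1 := congrArg alpha (hd Z)
  simp only [dZdagger, dz1, dz2, alpha_smul, alpha_add, alpha_sub, alpha_mul, alpha_i, alpha_j,
    alpha_zero] at h1
  have hre := congrArg Complex.re h1
  have him := congrArg Complex.im h1
  have hi (w : BC) := alpha_pd_of_mem_hyperbolic hF h w Z
  simp [hi] at hre him
  rw [pd_ofIdem]
  simp only [alpha_add, alpha_smul]
  apply Complex.ext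
  · simp
    linear_combination b.re * hre - b.im * him
  · simp [hi]

theorem beta_pd_ePlus_direction {F : BC → BC} (hF : Differentiable ℝ F)
    (h : ∀ Z, F Z ∈ hyperbolic) (hd : ∀ Z, dZdagger F Z = 0) (a : ℂ) (Z : BC) :
    beta (pd (ofIdem a 0) F Z) = 0 := by
  have h1 := congrArg beta (hd Z)
  simp only [dZdagger, dz1, dz2, beta_smul, beta_add, beta_sub, beta_mul, beta_i, beta_j,
    beta_zero] at h1
  have hre := congrArg Complex.re h1
  have him := congrArg Complex.im h1
  have hi (w : BC) := beta_pd_of_mem_hyperbolic hF h w Z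
  simp [hi] at hre him
  rw [pd_ofIdem]
  simp only [beta_add, beta_smul]
  apply Complex.ext
  · simp
    linear_combination a.re * hre - a.im * him
  · simp [hi]

/-- The derivative in `β` vanishes on the whole plane, so `β` may be moved to `0`. -/
theorem alpha_apply_eq {F : BC → BC} (hF : Differentiable ℝ F)
    (h : ∀ Z, F Z ∈ hyperbolic) (hd : ∀ Z, dZdagger F Z = 0) (Z : BC) :
    alpha (F Z) = alpha (F (ofIdem (alpha Z) 0)) := by
  have hder (b : ℂ) : HasFDerivAt (fun b ↦ alpha (F (ofIdem (alpha Z) b))) (0 : ℂ →L[ℝ] ℂ) b := by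
    have h1 : HasFDerivAt (fun b ↦ ofIdem (alpha Z) b)
        (ofIdemCLM.comp (ContinuousLinearMap.inr ℝ ℂ ℂ)) b :=
      ofIdemCLM.hasFDerivAt.comp b (hasFDerivAt_prodMk_right (alpha Z) b)
    have h2 : HasFDerivAt (fun b ↦ alpha (F (ofIdem (alpha Z) b))) _ b :=
      alphaCLM.hasFDerivAt.comp b ((hF _).hasFDerivAt.comp b h1)
    convert h2 using 1
    ext1 w
    exact (alpha_pd_eMinus_direction hF h hd w _).symm
  have := is_const_of_fderiv_eq_zero (fun b ↦ (hder b).differentiableAt)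
    (fun b ↦ (hder b).fderiv) (beta Z) 0
  rw [← this]
  congr 2
  exact eq_alpha_beta Z

theorem beta_apply_eq {F : BC → BC} (hF : Differentiable ℝ F)
    (h : ∀ Z, F Z ∈ hyperbolic) (hd : ∀ Z, dZdagger F Z = 0) (Z : BC) :
    beta (F Z) = beta (F (ofIdem 0 (beta Z))) := by
  have hder (a : ℂ) : HasFDerivAt (fun a ↦ beta (F (ofIdem a (beta Z)))) (0 : ℂ →L[ℝ] ℂ) a := by
    have h1 : HasFDerivAt (fun a ↦ ofIdem a (beta Z))
        (ofIdemCLM.comp (ContinuousLinearMap.inl ℝ ℂ ℂ)) a :=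
      ofIdemCLM.hasFDerivAt.comp a (hasFDerivAt_prodMk_left a (beta Z))
    have h2 : HasFDerivAt (fun a ↦ beta (F (ofIdem a (beta Z)))) _ a :=
      betaCLM.hasFDerivAt.comp a ((hF _).hasFDerivAt.comp a h1)
    convert h2 using 1
    ext1 w
    exact (beta_pd_ePlus_direction hF h hd w _).symm
  have := is_const_of_fderiv_eq_zero (fun a ↦ (hder a).differentiableAt)
    (fun a ↦ (hder a).fderiv) (alpha Z) 0
  rw [← this]
  congr 2
  exact eq_alpha_beta Z

theorem exists_polyholomorphic_of_isPolyharmonic {l : ℕ} {F : BC → BC}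
    (h : ∀ Z, F Z ∈ hyperbolic) (hF : IsPolyharmonic l F) (hd : ∀ Z, dZdagger F Z = 0) :
    ∃ f ∈ polyholomorphic l l, ∀ Z, F Z = reHyp (f Z) := by
  obtain ⟨hsmooth, hlap⟩ := hF
  -- The candidates for the components are read off on the two idempotent axes.
  let u : ℂ → ℝ := fun z ↦ (alpha (F (ofIdem z 0))).re
  let v : ℂ → ℝ := fun z ↦ (beta (F (ofIdem 0 z))).re
  have hu : ContDiff ℝ ((2 * l : ℕ) : WithTop ℕ∞) u :=
    reCLM.contDiff.comp (alphaCLM.contDiff.comp (hsmooth.comp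
      (ofIdemCLM.contDiff.comp (contDiff_id.prodMk contDiff_const))))
  have hv : ContDiff ℝ ((2 * l : ℕ) : WithTop ℕ∞) v :=
    reCLM.contDiff.comp (betaCLM.contDiff.comp (hsmooth.comp
      (ofIdemCLM.contDiff.comp (contDiff_const.prodMk contDiff_id))))
  have hsplit : F = split (fun z ↦ ofRealCLM (u z)) (fun z ↦ ofRealCLM (v z)) := by
    -- For `l = 0` the hypothesis gives only continuity, but `Δ⁰F = 0` already says `F = 0`.
    rcases l with _ | l
    · have hF0 : F = 0 := funext hlap
      funext Z
      apply ext_alpha_beta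
      · simp [split, alpha_ofIdem, u, hF0, alpha_zero]
      · simp [split, beta_ofIdem, v, hF0, beta_zero]
    · have hdiff : Differentiable ℝ F :=
        (hsmooth.of_le (two_le_two_mul_succ l)).differentiable (by norm_num)
      funext Z
      apply ext_alpha_beta
      · rw [split, alpha_ofIdem, alpha_apply_eq hdiff h hd, alpha_of_mem_hyperbolic (h _)]
        rfl
      · rw [split, beta_ofIdem, beta_apply_eq hdiff h hd, beta_of_mem_hyperbolic (h _)]
        rfl
  -- The components of `Δˡ F = 0` are `qlap^[l] u = 0` and `qlap^[l] v = 0`, read in `ℂ`.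
  have hlap' : split (fun z ↦ ofRealCLM (qlap^[l] u z)) (fun z ↦ ofRealCLM (qlap^[l] v z)) = 0 := by
    rw [← qlap_iterate_comp_left ofRealCLM l hu, ← qlap_iterate_comp_left ofRealCLM l hv,
      ← laplacianBC_iterate_split l (u := fun z ↦ ofRealCLM (u z)) (v := fun z ↦ ofRealCLM (v z))
        (ofRealCLM.contDiff.comp hu) (ofRealCLM.contDiff.comp hv),
      ← hsplit]
    exact funext hlap
  have hu0 : qlap^[l] u = 0 := by
    funext z
    have := congrArg alpha (congrFun hlap' (ofIdem z 0))
    simpa [split, alpha_ofIdem, alpha_zero] using this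
  have hv0 : qlap^[l] v = 0 := by
    funext z
    have := congrArg beta (congrFun hlap' (ofIdem 0 z))
    simpa [split, beta_ofIdem, beta_zero] using this
  obtain ⟨φ, hφ, hφu⟩ := exists_mem_polyanalytic_re_eq l hu hu0
  obtain ⟨ψ, hψ, hψv⟩ := exists_mem_polyanalytic_re_eq l hv hv0
  refine ⟨split φ ψ, ⟨φ, hφ, ψ, hψ, fun _ ↦ rfl⟩, fun Z ↦ ?_⟩
  rw [hsplit]
  apply ext_alpha_beta
  · rw [alpha_reHyp, split, split, alpha_ofIdem, alpha_ofIdem, ← hφu]; rfl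
  · rw [beta_reHyp, split, split, beta_ofIdem, beta_ofIdem, ← hψv]; rfl

end Bicomplex

end

theorem theorem1p3 :
    (∀ (m n : ℕ) (f : Bicomplex.BC → Bicomplex.BC), f ∈ Bicomplex.polyholomorphic m n →
      Bicomplex.IsPolyharmonic (max m n) (fun Z => Bicomplex.reHyp (f Z))) ∧
    (∀ (l : ℕ) (F : Bicomplex.BC → Bicomplex.BC), (∀ Z, F Z ∈ Bicomplex.hyperbolic) →
      Bicomplex.IsPolyharmonic l F →
      (∀ Z, Bicomplex.dZdagger F Z = 0) → (∀ Z, Bicomplex.dZtilde F Z = 0) →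
      ∃ m n : ℕ, max m n = l ∧ ∃ f ∈ Bicomplex.polyholomorphic m n,
        ∀ Z, F Z = Bicomplex.reHyp (f Z)) := by
  refine ⟨fun m n f hf ↦ Bicomplex.isPolyharmonic_reHyp_of_mem_polyholomorphic hf,
    fun l F h hF hd _ ↦ ⟨l, l, max_self l, ?_⟩⟩
  exact Bicomplex.exists_polyholomorphic_of_isPolyharmonic h hF hd
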